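/- Let $\mathcal A=[K]$ be a finite set of actions, $\mathcal X$ a measurable space of contexts, $\mathcal S$ a finite set of latent states, $P_1$ a probability distribution (prior) on $\mathcal S$, and let $P(\cdot\mid a,x,s,\theta)$, $\theta\in\Theta$, be conditional reward distributions on $\mathbb R$ (probability kernels in $(a,x,s)$) with means $\mu(a,x,s,\theta)$. Fix the true parameter $\theta_*\in\Theta$ and $\sigma\ge 0$. Assume that rewards are $\sigma^2$-sub-Gaussian, i.e. $\mathbb E_{R\sim P(\cdot\mid a,x,s,\theta_*)}[\exp(\lambda(R-\mu(a,x,s,\theta_*)))]\le\exp(\sigma^2\lambda^2/2)$ for all $a,x,s$ and all $\lambda\in\mathbb R$, and that the suboptimality of every action is at most $1$, i.e. $\max_{a'}\mu(a',x,s,\theta_*)-\mu(a,x,s,\theta_*)\le 1$ for all $a,x,s$. The latent state $S_*\sim P_1$ is drawn once. In round $t=1,2,\dots$, with history $H_t=(X_\ell,A_\ell,R_\ell)_{\ell<t}$, a context $X_t$ is generated by an arbitrary probability kernel from $H_t$ (so that $X_t$ is independent of $S_*$ given $H_t$), the agent chooses an action $A_t\in\mathcal A$, and the reward $R_t$ is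 drawn from $P(\cdot\mid A_t,X_t,S_*,\theta_*)$. The algorithm mTS with model parameter $\hat\theta$ computes the posterior $P_t(s)\propto P_1(s)\prod_{\ell<t}P(R_\ell\mid A_\ell,X_\ell,s,\hat\theta)$ (with $P(r\mid\cdot)$ denoting likelihoods, i.e. densities with respect to a common dominating measure), samples $B_t\sim P_t$ independently of everything else given $H_t$, and plays $A_t\in\arg\max_{a\in\mathcal A}\mu(a,X_t,B_t,\hat\theta)$, where ties are broken by a fixed measurable rule. Assume that the model is known exactly, $\hat\theta=\theta_*$. Then for every $\theta_*\in\Theta$ and every $n$, the $n$-round Bayes regret of mTS, $$\mathcal{BR}(n)=\mathbb E\Big[\sum_{t=1}^n\Big(\max_{a\in\mathcal A}\mu(a,X_t,S_*,\theta_*)-\mu(A_t,X_t,S_*,\theta_*)\Big)\Big],$$ is well defined (the sum is integrable) and satisfies $$\mathcal{BR}(n)\le 3|\mathcal S|+2\sigma\sqrt{6|\mathcal S|\,n\log n}.$$ -/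

import Mathlib

open MeasureTheory ProbabilityTheory
open scoped ENNReal NNReal

namespace LatentBandit

/-- The record of one round: the context `X_t`, the latent state `B_t` sampled by the agent,
the action `A_t` and the reward `R_t`. -/
abbrev Round (𝒳 𝒮 : Type*) (K : ℕ) := 𝒳 × 𝒮 × Fin K × ℝ

/-- The observation history `H_t`: the triples (context, action, reward) of `t` past rounds. -/
abbrev Hist (𝒳 : Type*) (K t : ℕ) := Fin t → 𝒳 × Fin K × ℝ

section

variable {𝒳 𝒮 Θ : Type*} {K : ℕ}

/-- The observation history contained in the records of `t` rounds (the sampled latent states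
`B_ℓ` are not part of it). -/
def obs {t : ℕ} (ω : Fin t → Round 𝒳 𝒮 K) : Hist 𝒳 K t :=
  fun i => ((ω i).1, (ω i).2.2.1, (ω i).2.2.2)

variable [MeasurableSpace 𝒳] [MeasurableSpace 𝒮]

lemma measurable_obs {t : ℕ} : Measurable (obs (𝒳 := 𝒳) (𝒮 := 𝒮) (K := K) (t := t)) := by
  unfold obs
  fun_prop

/-- The mean reward `μ(a, x, s, θ)` of a family `P` of conditional reward distributions. -/
noncomputable def meanReward (P : Θ → Kernel (Fin K × 𝒳 × 𝒮) ℝ) (a : Fin K) (x : 𝒳) (s : 𝒮)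
    (θ : Θ) : ℝ :=
  ∫ r, r ∂(P θ (a, x, s))

/-- The reward distributions under `θ` in a fixed latent state `s`. -/
noncomputable def stateKernel (P : Θ → Kernel (Fin K × 𝒳 × 𝒮) ℝ) (θ : Θ) (s : 𝒮) :
    Kernel (Fin K × 𝒳) ℝ :=
  (P θ).comap (fun q => (q.1, q.2, s)) (by fun_prop)

variable [Fintype 𝒮]

/-- The likelihood `P(r ∣ a, x, s, θ)`: the density of the reward distribution in state `s` with
respect to the measure `∑ s', P(· ∣ a, x, s', θ)`, which dominates all of them. (The posterior does
not depend on the choice of the dominating measure.) -/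
noncomputable def likelihood (P : Θ → Kernel (Fin K × 𝒳 × 𝒮) ℝ) (θ : Θ) (s : 𝒮)
    (o : 𝒳 × Fin K × ℝ) : ℝ≥0∞ :=
  Kernel.rnDeriv (stateKernel P θ s) (∑ s', stateKernel P θ s') (o.2.1, o.1) o.2.2

/-- The unnormalized posterior weight `P₁(s) ∏_ℓ P(R_ℓ ∣ A_ℓ, X_ℓ, s, θ)`. -/
noncomputable def weight (P : Θ → Kernel (Fin K × 𝒳 × 𝒮) ℝ) (θ : Θ) (P₁ : Measure 𝒮) {t : ℕ}
    (h : Hist 𝒳 K t) (s : 𝒮) : ℝ≥0∞ :=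
  P₁ {s} * ∏ i, likelihood P θ s (h i)

/-- The normalization constant of the posterior. -/
noncomputable def evidence (P : Θ → Kernel (Fin K × 𝒳 × 𝒮) ℝ) (θ : Θ) (P₁ : Measure 𝒮) {t : ℕ}
    (h : Hist 𝒳 K t) : ℝ≥0∞ :=
  ∑ s, weight P θ P₁ h s

open scoped Classical in
/-- The posterior `P_t(s) ∝ P₁(s) ∏_ℓ P(R_ℓ ∣ A_ℓ, X_ℓ, s, θ)` given the history. On the
histories for which the weights cannot be normalized it is set to the prior. -/
noncomputable def posteriorMeasure (P : Θ → Kernel (Fin K × 𝒳 × 𝒮) ℝ) (θ : Θ) (P₁ : Measure 𝒮)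
    {t : ℕ} (h : Hist 𝒳 K t) : Measure 𝒮 :=
  if evidence P θ P₁ h = 0 ∨ evidence P θ P₁ h = ∞ then P₁
  else ∑ s, (weight P θ P₁ h s / evidence P θ P₁ h) • Measure.dirac s

lemma measurable_weight (P : Θ → Kernel (Fin K × 𝒳 × 𝒮) ℝ) (θ : Θ) (P₁ : Measure 𝒮) {t : ℕ}
    (s : 𝒮) : Measurable (fun h : Hist 𝒳 K t => weight P θ P₁ h s) := by
  unfold weight likelihood
  refine Measurable.const_mul (Finset.measurable_prod _ fun i _ => ?_) _
  have hf : Measurable (fun q : Hist 𝒳 K t => (((q i).2.1, (q i).1), (q i).2.2)) := by fun_prop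
  exact (Kernel.measurable_rnDeriv (stateKernel P θ s) (∑ s', stateKernel P θ s')).comp hf

lemma measurable_evidence (P : Θ → Kernel (Fin K × 𝒳 × 𝒮) ℝ) (θ : Θ) (P₁ : Measure 𝒮) {t : ℕ} :
    Measurable (fun h : Hist 𝒳 K t => evidence P θ P₁ h) := by
  unfold evidence
  exact Finset.measurable_sum _ fun s _ => measurable_weight P θ P₁ s

lemma measurable_posteriorMeasure (P : Θ → Kernel (Fin K × 𝒳 × 𝒮) ℝ) (θ : Θ) (P₁ : Measure 𝒮)
    {t : ℕ} : Measurable (fun h : Hist 𝒳 K t => posteriorMeasure P θ P₁ h) := by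
  classical
  unfold posteriorMeasure
  have hE := measurable_evidence (t := t) P θ P₁
  refine Measurable.ite ?_ measurable_const ?_
  · exact (hE (measurableSet_singleton 0)).union (hE (measurableSet_singleton ∞))
  · refine Measure.measurable_of_measurable_coe _ fun A _ => ?_
    simp only [Measure.coe_finsetSum, Finset.sum_apply, Measure.smul_apply, smul_eq_mul]
    exact Finset.measurable_sum _ fun s _ =>
      ((measurable_weight P θ P₁ s).div hE).mul_const _

/-- The posterior as a Markov kernel from histories to latent states. -/
noncomputable def posteriorKernel (P : Θ → Kernel (Fin K × 𝒳 × 𝒮) ℝ) (θ : Θ) (P₁ : Measure 𝒮)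
    (t : ℕ) : Kernel (Hist 𝒳 K t) 𝒮 :=
  ⟨posteriorMeasure P θ P₁, measurable_posteriorMeasure P θ P₁⟩

instance (P : Θ → Kernel (Fin K × 𝒳 × 𝒮) ℝ) (θ : Θ) (P₁ : Measure 𝒮) [IsProbabilityMeasure P₁]
    (t : ℕ) : IsMarkovKernel (posteriorKernel P θ P₁ t) := by
  classical
  refine ⟨fun h => ⟨?_⟩⟩
  change posteriorMeasure P θ P₁ h Set.univ = 1
  unfold posteriorMeasure
  split_ifs with hz
  · exact measure_univ
  · push Not at hz
    simp only [Measure.coe_finsetSum, Finset.sum_apply, Measure.smul_apply, smul_eq_mul,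
      measure_univ, mul_one, ENNReal.div_eq_inv_mul]
    rw [← Finset.mul_sum]
    exact ENNReal.inv_mul_cancel hz.1 hz.2

/-- The context `X` of a round, drawn from `ctx t` given the history; the latent state has no
influence on it beyond the history. -/
noncomputable def contextStep {t : ℕ} (κ : Kernel (Hist 𝒳 K t) 𝒳) :
    Kernel (𝒮 × (Fin t → Round 𝒳 𝒮 K)) 𝒳 :=
  κ.comap (fun p => obs p.2) (measurable_obs.comp measurable_snd)

/-- The state `B` sampled by the agent, drawn from the posterior given the history. -/
noncomputable def sampleStep (P : Θ → Kernel (Fin K × 𝒳 × 𝒮) ℝ) (θhat : Θ) (P₁ : Measure 𝒮)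
    (t : ℕ) : Kernel ((𝒮 × (Fin t → Round 𝒳 𝒮 K)) × 𝒳) 𝒮 :=
  (posteriorKernel P θhat P₁ t).comap (fun p => obs p.1.2)
    (measurable_obs.comp (measurable_snd.comp measurable_fst))

/-- The reward, drawn from `P(· ∣ A, X, s, θstar)` with `A = select X B` and `s` the latent
state. -/
noncomputable def rewardStep (P : Θ → Kernel (Fin K × 𝒳 × 𝒮) ℝ) (θstar : Θ)
    (select : 𝒳 → 𝒮 → Fin K) (hselect : Measurable (Function.uncurry select)) (t : ℕ) :
    Kernel ((𝒮 × (Fin t → Round 𝒳 𝒮 K)) × 𝒳 × 𝒮) ℝ :=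
  (P θstar).comap (fun p => (select p.2.1 p.2.2, p.2.1, p.1.1))
    ((hselect.comp measurable_snd).prodMk
      ((measurable_fst.comp measurable_snd).prodMk (measurable_fst.comp measurable_fst)))

/-- One round of the interaction of `mTS` (run with the model parameter `θhat`, the prior `P₁` and
the maximizing action `select x b` in context `x` and sampled state `b`) with the environment (true
parameter `θstar`), given the latent state and the records of the past rounds: the context `X`, the
sampled state `B`, the action `A = select X B` and the reward `R`. -/
noncomputable def stepKernel (P : Θ → Kernel (Fin K × 𝒳 × 𝒮) ℝ) (θstar θhat : Θ)
    (P₁ : Measure 𝒮) (ctx : (t : ℕ) → Kernel (Hist 𝒳 K t) 𝒳)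
    (select : 𝒳 → 𝒮 → Fin K) (hselect : Measurable (Function.uncurry select)) (t : ℕ) :
    Kernel (𝒮 × (Fin t → Round 𝒳 𝒮 K)) (Round 𝒳 𝒮 K) :=
  ((contextStep (ctx t) ⊗ₖ sampleStep P θhat P₁ t) ⊗ₖ
    rewardStep P θstar select hselect t).map
    (fun q => (q.1.1, q.1.2, select q.1.1 q.1.2, q.2))

/-- The joint law of the latent state `S_* ∼ P₁` and of the records of the first `t` rounds. -/
noncomputable def law (P : Θ → Kernel (Fin K × 𝒳 × 𝒮) ℝ) (θstar θhat : Θ)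
    (P₁ : Measure 𝒮) (ctx : (t : ℕ) → Kernel (Hist 𝒳 K t) 𝒳)
    (select : 𝒳 → 𝒮 → Fin K) (hselect : Measurable (Function.uncurry select)) :
    (t : ℕ) → Measure (𝒮 × (Fin t → Round 𝒳 𝒮 K))
  | 0 => P₁.map (fun s => (s, Fin.elim0))
  | t + 1 =>
    ((law P θstar θhat P₁ ctx select hselect t) ⊗ₘ
      (stepKernel P θstar θhat P₁ ctx select hselect t)).map
      (fun q => (q.1.1, Fin.snoc (α := fun _ => Round 𝒳 𝒮 K) q.1.2 q.2))

/-- The regret accumulated over `n` rounds when the latent state is `p.1` and the records of the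
rounds are `p.2`: the sum over the rounds of `max_a μ(a, X_t, s, θ) - μ(A_t, X_t, s, θ)`. -/
noncomputable def totalRegret (P : Θ → Kernel (Fin K × 𝒳 × 𝒮) ℝ) (θ : Θ) {n : ℕ}
    (p : 𝒮 × (Fin n → Round 𝒳 𝒮 K)) : ℝ :=
  ∑ t, ((⨆ a, meanReward P a (p.2 t).1 p.1 θ) - meanReward P (p.2 t).2.2.1 (p.2 t).1 p.1 θ)

/-- The `n`-round Bayes regret of `mTS`. -/
noncomputable def bayesRegret (P : Θ → Kernel (Fin K × 𝒳 × 𝒮) ℝ) (θstar θhat : Θ)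
    (P₁ : Measure 𝒮) (ctx : (t : ℕ) → Kernel (Hist 𝒳 K t) 𝒳)
    (select : 𝒳 → 𝒮 → Fin K) (hselect : Measurable (Function.uncurry select)) (n : ℕ) : ℝ :=
  ∫ p, totalRegret P θstar p ∂(law P θstar θhat P₁ ctx select hselect n)

end

end LatentBandit

/-!
With respect to the law that the history would have if all rewards came from a common dominating
kernel, the joint law of `S_*` and of the history has the posterior weights as its density. Hence
`S_*` and `B_t` are independent with the same law given the history, and by symmetry the regret of a
round can be replaced by the gap between the means of the action of `B_t` in the states `B_t` and
`S_*`. When that gap is large, the sub-Gaussian rewards of this action tell the two states apart: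
the affinity `∫ f ^ (1 - α) g ^ α` of their densities is small. The expectation of the potential
`∑ s b, P_t(s) ^ (1 - α) P_t(b) ^ α`, which is at most `|𝒮|` in the beginning, then decreases, and
its total decrease pays for the regret, except for pairs of states where `P_t(B_t)` is less than
`P_t(S_*) / N`; these are negligible. The bound follows with `α = 1 / (8 log n)` and `N = n ^ 2`,
for which `N ^ α` is a constant, after optimizing over the tilting parameter `1 / A` of the
affinity bound.
-/

namespace LatentBandit

section RealInequalities

lemma le_add_two_sqrt_of_forall_pos {r C a b : ℝ} (ha : 0 < a) (hb : 0 ≤ b)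
    (h : ∀ x > 0, r ≤ C + a * x + b / x) : r ≤ C + 2 * √(a * b) := by
  rcases hb.eq_or_lt with rfl | hb
  · simp only [zero_div, add_zero, mul_zero, Real.sqrt_zero] at h ⊢
    refine le_of_forall_pos_le_add fun ε hε => ?_
    simpa [mul_div_cancel₀ ε ha.ne'] using h (ε / a) (by positivity)
  · have : 0 < √(a * b) := by positivity
    have hleft : a * (√(a * b) / a) = √(a * b) := by field_simp
    have hright : b / (√(a * b) / a) = √(a * b) := by
      rw [div_eq_iff (by positivity), ← mul_div_assoc, Real.mul_self_sqrt (by positivity)]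
      field_simp
    have hopt := h (√(a * b) / a) (by positivity)
    rw [hleft, hright] at hopt
    linarith

lemma le_mul_one_sub_add_of_le_exp {x y A B β : ℝ} (hA : 0 < A) (hB : 0 ≤ B) (hy : y ≤ 2)
    (hyx : y ≤ x) (hβ0 : 0 ≤ β) (hβ1 : β ≤ 1) (hβ : β ≤ Real.exp (-((x - B) / A))) :
    y ≤ (2 + A) * (1 - β) + B := by
  set w := (y - B) / A with hw
  have hyw : y = A * w + B := by rw [hw]; field_simp; ring
  have hβw : β * (1 + w) ≤ 1 :=
    calc β * (1 + w) ≤ Real.exp (-w) * Real.exp w := by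
          have hwx : -((x - B) / A) ≤ -w := by rw [hw]; gcongr
          have h1w : 1 + w ≤ Real.exp w := by linarith [Real.add_one_le_exp w]
          exact (mul_le_mul_of_nonneg_left h1w hβ0).trans
            (mul_le_mul_of_nonneg_right (hβ.trans (Real.exp_le_exp.2 hwx)) (Real.exp_pos w).le)
      _ = 1 := by rw [← Real.exp_add, neg_add_cancel, Real.exp_zero]
  calc y = (1 - β) * y + A * (β * w) + β * B := by linear_combination β * hyw
    _ ≤ (1 - β) * 2 + A * (1 - β) + 1 * B := by
        have : 0 ≤ 1 - β := sub_nonneg.2 hβ1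
        gcongr
        linarith
    _ = (2 + A) * (1 - β) + B := by ring

end RealInequalities

section Affinity

variable {Ω : Type*} [MeasurableSpace Ω]

/-- The Rényi affinity `∫ f ^ (1 - α) g ^ α dμ` of the densities `f` and `g`; it measures how hard
it is to tell the two distributions apart. -/
noncomputable def affinity (α : ℝ) (μ : Measure Ω) (f g : Ω → ℝ≥0∞) : ℝ≥0∞ :=
  ∫⁻ ω, f ω ^ (1 - α) * g ω ^ α ∂μ

lemma lintegral_exp_le_of_hasSubgaussianMGF {μ : Measure Ω} {X : Ω → ℝ} {c : ℝ≥0}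
    (h : HasSubgaussianMGF X c μ) (t : ℝ) :
    ∫⁻ ω, ENNReal.ofReal (Real.exp (t * X ω)) ∂μ ≤ ENNReal.ofReal (Real.exp (c * t ^ 2 / 2)) := by
  rw [← ofReal_integral_eq_lintegral_ofReal (h.integrable_exp_mul t)
    (Filter.Eventually.of_forall fun _ => (Real.exp_pos _).le)]
  exact ENNReal.ofReal_le_ofReal (h.mgf_le t)

lemma lintegral_mul_exp_le_of_hasSubgaussianMGF_withDensity {μ : Measure Ω} {X : Ω → ℝ}
    (hX : Measurable X) {f : Ω → ℝ≥0∞} (hf : Measurable f) {u : ℝ} {c : ℝ≥0}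
    (h : HasSubgaussianMGF (fun ω => X ω - u) c (μ.withDensity f)) (t : ℝ) :
    ∫⁻ ω, f ω * ENNReal.ofReal (Real.exp (t * (X ω - u))) ∂μ ≤
      ENNReal.ofReal (Real.exp (c * t ^ 2 / 2)) := by
  simpa only [lintegral_withDensity_eq_lintegral_mul _ hf
    (show Measurable fun ω => ENNReal.ofReal (Real.exp (t * (X ω - u))) by fun_prop), Pi.mul_apply]
    using lintegral_exp_le_of_hasSubgaussianMGF h t

lemma affinity_mul_mul {α : ℝ} (hα0 : 0 ≤ α) (hα1 : α ≤ 1) {μ : Measure Ω} {f g : Ω → ℝ≥0∞}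
    (hf : Measurable f) (hg : Measurable g) (C D : ℝ≥0∞) :
    affinity α μ (fun ω => C * f ω) (fun ω => D * g ω) =
      C ^ (1 - α) * D ^ α * affinity α μ f g := by
  simp only [affinity, ENNReal.mul_rpow_of_nonneg _ _ hα0,
    ENNReal.mul_rpow_of_nonneg _ _ (sub_nonneg.2 hα1), mul_mul_mul_comm]
  exact lintegral_const_mul _ (by fun_prop)

/-- Tilting `f` by `exp (l / (1 - α) * (X - u))` and `g` by `exp (-l / α * (X - v))` multiplies the
integrand by the constant `exp (l * (v - u))`; Hölder's inequality then separates the two moment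
generating functions. -/
lemma affinity_le_of_hasSubgaussianMGF {μ : Measure Ω} {X : Ω → ℝ} (hX : Measurable X)
    {f g : Ω → ℝ≥0∞} (hf : Measurable f) (hg : Measurable g) {u v : ℝ} {c : ℝ≥0}
    (hfX : HasSubgaussianMGF (fun ω => X ω - u) c (μ.withDensity f))
    (hgX : HasSubgaussianMGF (fun ω => X ω - v) c (μ.withDensity g))
    {α : ℝ} (hα0 : 0 < α) (hα1 : α < 1) (l : ℝ) :
    affinity α μ f g ≤
      ENNReal.ofReal (Real.exp (-(l * (v - u) - c / (2 * α * (1 - α)) * l ^ 2))) := by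
  have hα1' : 0 < 1 - α := sub_pos.2 hα1
  set e : ℝ → ℝ≥0∞ := fun y => ENNReal.ofReal (Real.exp y) with he
  have he_mul (y z : ℝ) : e y * e z = e (y + z) := by
    rw [he, ← ENNReal.ofReal_mul (Real.exp_pos _).le, ← Real.exp_add]
  have he_rpow (y a : ℝ) : e y ^ a = e (y * a) := by
    rw [he, ENNReal.ofReal_rpow_of_pos (Real.exp_pos _), ← Real.exp_mul]
  set F : Ω → ℝ≥0∞ := fun ω => f ω * e (l / (1 - α) * (X ω - u)) with hF
  set G : Ω → ℝ≥0∞ := fun ω => g ω * e (-l / α * (X ω - v)) with hG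
  have hFm : Measurable F := by fun_prop
  have hGm : Measurable G := by fun_prop
  have htilt (ω : Ω) : f ω ^ (1 - α) * g ω ^ α =
      e (-(l * (v - u))) * (F ω ^ (1 - α) * G ω ^ α) := by
    have hexp : -(l * (v - u)) +
        (l / (1 - α) * (X ω - u) * (1 - α) + -l / α * (X ω - v) * α) = 0 := by
      field_simp; ring
    have hone : e (-(l * (v - u))) * (e (l / (1 - α) * (X ω - u) * (1 - α)) *
        e (-l / α * (X ω - v) * α)) = 1 := by
      rw [he_mul, he_mul, hexp]
      simp [he]
    simp only [hF, hG, ENNReal.mul_rpow_of_nonneg _ _ hα0.le,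
      ENNReal.mul_rpow_of_nonneg _ _ hα1'.le, he_rpow]
    rw [mul_mul_mul_comm, mul_left_comm, hone, mul_one]
  calc affinity α μ f g = e (-(l * (v - u))) * ∫⁻ ω, F ω ^ (1 - α) * G ω ^ α ∂μ := by
        simp only [affinity, htilt]
        exact lintegral_const_mul _ (by fun_prop)
    _ ≤ e (-(l * (v - u))) * ((∫⁻ ω, F ω ∂μ) ^ (1 - α) * (∫⁻ ω, G ω ∂μ) ^ α) := by
        gcongr
        exact ENNReal.lintegral_mul_norm_pow_le hFm.aemeasurable hGm.aemeasurable hα1'.le hα0.le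
          (sub_add_cancel 1 α)
    _ ≤ e (-(l * (v - u))) *
          (e (c * (l / (1 - α)) ^ 2 / 2) ^ (1 - α) * e (c * (-l / α) ^ 2 / 2) ^ α) := by
        gcongr
        · exact lintegral_mul_exp_le_of_hasSubgaussianMGF_withDensity hX hf hfX _
        · exact lintegral_mul_exp_le_of_hasSubgaussianMGF_withDensity hX hg hgX _
    _ = e (-(l * (v - u) - c / (2 * α * (1 - α)) * l ^ 2)) := by
        rw [he_rpow, he_rpow, he_mul, he_mul]
        congr 1
        field_simp
        ring

end Affinity

section Potential

variable {S : Type*} [Fintype S]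

/-- The potential `∑ s b, w s ^ (1 - α) * w b ^ α` of the weights `w` over the hypotheses `S`; it is
small once the weights concentrate on a single hypothesis. -/
noncomputable def potential (α : ℝ) (w : S → ℝ≥0∞) : ℝ≥0∞ :=
  ∑ s, ∑ b, w s ^ (1 - α) * w b ^ α

/-- The expected potential of the posterior after a sample `c` is drawn from the prior `p` and an
experiment is run for which `β c s b` is the affinity of the outcomes under `s` and `b`. -/
noncomputable def nextPotential (α : ℝ) (p : S → ℝ≥0∞) (β : S → S → S → ℝ≥0∞) : ℝ≥0∞ :=
  ∑ s, ∑ b, p s ^ (1 - α) * p b ^ α * ∑ c, p c * β c s b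

/-- The average over independent `s` and `b` with masses `p` of the loss `r s b`. -/
noncomputable def samplingLoss (p : S → ℝ≥0∞) (r : S → S → ℝ≥0∞) : ℝ≥0∞ :=
  ∑ s, ∑ b, p s * p b * r s b

variable {α : ℝ} {p : S → ℝ≥0∞}

lemma potential_const_mul (hα0 : 0 ≤ α) (hα1 : α ≤ 1) (C : ℝ≥0∞) (w : S → ℝ≥0∞) :
    potential α (fun s => C * w s) = C * potential α w := by
  have hC : C ^ (1 - α) * C ^ α = C := by
    rw [← ENNReal.rpow_add_of_nonneg _ _ (sub_nonneg.2 hα1) hα0, sub_add_cancel, ENNReal.rpow_one]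
  simp only [potential, ENNReal.mul_rpow_of_nonneg _ _ hα0,
    ENNReal.mul_rpow_of_nonneg _ _ (sub_nonneg.2 hα1), mul_mul_mul_comm, hC, Finset.mul_sum]

lemma potential_le_card_mul_sum (hα0 : 0 ≤ α) (hα1 : α ≤ 1) (w : S → ℝ≥0∞) :
    potential α w ≤ Fintype.card S * ∑ s, w s := by
  let _ : MeasurableSpace S := ⊤
  have hfst : ∑ z : S × S, w z.1 = Fintype.card S * ∑ s, w s := by
    simp [Fintype.sum_prod_type, Finset.mul_sum]
  have hsnd : ∑ z : S × S, w z.2 = Fintype.card S * ∑ s, w s := by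
    simp [Fintype.sum_prod_type_right, Finset.mul_sum]
  calc potential α w = ∫⁻ z : S × S, w z.1 ^ (1 - α) * w z.2 ^ α ∂Measure.count := by
        simp [potential, Fintype.sum_prod_type, lintegral_fintype]
    _ ≤ (∫⁻ z : S × S, w z.1 ∂Measure.count) ^ (1 - α) *
          (∫⁻ z : S × S, w z.2 ∂Measure.count) ^ α :=
        ENNReal.lintegral_mul_norm_pow_le (measurable_of_finite _).aemeasurable
          (measurable_of_finite _).aemeasurable (sub_nonneg.2 hα1) hα0 (sub_add_cancel 1 α)
    _ = Fintype.card S * ∑ s, w s := by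
        simp only [lintegral_fintype, Measure.count_singleton, mul_one, hfst, hsnd]
        rw [← ENNReal.rpow_add_of_nonneg _ _ (sub_nonneg.2 hα1) hα0, sub_add_cancel,
          ENNReal.rpow_one]

lemma lintegral_potential_mul {Ω : Type*} [MeasurableSpace Ω] (hα0 : 0 ≤ α) (hα1 : α ≤ 1)
    (μ : Measure Ω) (w : S → ℝ≥0∞) {f : S → Ω → ℝ≥0∞} (hf : ∀ s, Measurable (f s)) :
    ∫⁻ ω, potential α (fun s => w s * f s ω) ∂μ =
      ∑ s, ∑ b, w s ^ (1 - α) * w b ^ α * affinity α μ (f s) (f b) := by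
  unfold potential
  rw [lintegral_finsetSum _ fun s _ => by fun_prop]
  refine Finset.sum_congr rfl fun s _ => ?_
  rw [lintegral_finsetSum _ fun b _ => by fun_prop]
  exact Finset.sum_congr rfl fun b _ => affinity_mul_mul hα0 hα1 (hf s) (hf b) _ _

lemma sum_mul_lintegral_potential_mul {Ω : Type*} [MeasurableSpace Ω] (hα0 : 0 ≤ α) (hα1 : α ≤ 1)
    (μ : S → Measure Ω) {f : S → S → Ω → ℝ≥0∞} (hf : ∀ c s, Measurable (f c s)) :
    ∑ c, p c * ∫⁻ ω, potential α (fun s => p s * f c s ω) ∂μ c =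
      nextPotential α p (fun c s b => affinity α (μ c) (f c s) (f c b)) := by
  simp only [lintegral_potential_mul hα0 hα1 _ p (hf _), nextPotential, Finset.mul_sum]
  rw [Finset.sum_comm]
  refine Finset.sum_congr rfl fun s _ => ?_
  rw [Finset.sum_comm]
  exact Finset.sum_congr rfl fun b _ => Finset.sum_congr rfl fun c _ => mul_left_comm _ _ _

lemma samplingLoss_le_of_add_swap_le {r φ : S → S → ℝ≥0∞}
    (h : ∀ s b, r s b + r b s ≤ φ s b + φ b s) : samplingLoss p r ≤ samplingLoss p φ := by
  have hswap (f : S → S → ℝ≥0∞) :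
      2 * samplingLoss p f = ∑ s, ∑ b, p s * p b * (f s b + f b s) := by
    simp only [mul_add, Finset.sum_add_distrib, samplingLoss, two_mul]
    congr 1
    rw [Finset.sum_comm]
    simp only [mul_comm]
  rw [← ENNReal.mul_le_mul_iff_right two_ne_zero ENNReal.ofNat_ne_top, hswap, hswap]
  exact Finset.sum_le_sum fun s _ => Finset.sum_le_sum fun b _ => mul_le_mul' le_rfl (h s b)

lemma le_rpow_mul_of_le_mul (hα0 : 0 ≤ α) (hα1 : α ≤ 1) {x y N : ℝ≥0∞} (h : x ≤ N * y) :
    x ≤ N ^ α * (x ^ (1 - α) * y ^ α) :=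
  calc x = x ^ (1 - α) * x ^ α := by
        rw [← ENNReal.rpow_add_of_nonneg _ _ (sub_nonneg.2 hα1) hα0, sub_add_cancel,
          ENNReal.rpow_one]
    _ ≤ x ^ (1 - α) * (N * y) ^ α := by gcongr
    _ = N ^ α * (x ^ (1 - α) * y ^ α) := by
        rw [ENNReal.mul_rpow_of_nonneg _ _ hα0, mul_left_comm]

/-- If `y` is at least the fraction `1 / N` of `x`, then `x` is comparable to `x ^ (1 - α) * y ^ α`;
otherwise `y` is negligible. -/
lemma mul_mul_le_rpow_mul_add (hα0 : 0 ≤ α) (hα1 : α ≤ 1) {x y φ β κ ε M N : ℝ≥0∞} (hN0 : N ≠ 0)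
    (hN : N ≠ ∞) (hx : x ≤ 1) (hφM : φ ≤ M) (hφ : φ ≤ κ * (1 - β) + ε) :
    x * y * φ ≤
      N ^ α * κ * (x ^ (1 - α) * y ^ α * (y * (1 - β))) + x * y * ε + M * N⁻¹ * x := by
  rcases le_total x (N * y) with hxy | hyx
  · refine le_add_right ?_
    calc x * y * φ ≤ x * y * (κ * (1 - β) + ε) := by gcongr
      _ = x * (y * κ * (1 - β)) + x * y * ε := by ring
      _ ≤ N ^ α * (x ^ (1 - α) * y ^ α) * (y * κ * (1 - β)) + x * y * ε := by
          gcongr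
          exact le_rpow_mul_of_le_mul hα0 hα1 hxy
      _ = N ^ α * κ * (x ^ (1 - α) * y ^ α * (y * (1 - β))) + x * y * ε := by ring
  · refine le_add_left ?_
    calc x * y * φ ≤ 1 * (N⁻¹ * x) * M := by
          gcongr
          exact (ENNReal.mul_le_iff_le_inv hN0 hN).1 hyx
      _ = M * N⁻¹ * x := by ring

lemma samplingLoss_le_sum_add (hα0 : 0 ≤ α) (hα1 : α ≤ 1) (hp : ∑ s, p s = 1)
    {φ : S → S → ℝ≥0∞} {β : S → S → S → ℝ≥0∞} {κ ε M N : ℝ≥0∞} (hN0 : N ≠ 0) (hN : N ≠ ∞)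
    (hφ0 : ∀ s, φ s s = 0) (hφM : ∀ s b, φ s b ≤ M)
    (hφ : ∀ s b, φ s b ≤ κ * (1 - β b s b) + ε) :
    samplingLoss p φ ≤
      N ^ α * κ * ∑ s, ∑ b, p s ^ (1 - α) * p b ^ α * (p b * (1 - β b s b)) + ε +
        M * N⁻¹ * (Fintype.card S - 1 : ℕ) := by
  classical
  have hp1 (s : S) : p s ≤ 1 := hp ▸ Finset.single_le_sum_of_canonicallyOrdered (Finset.mem_univ s)
  have hε : ∑ s, ∑ b, p s * p b * ε = ε := by
    simp only [← Finset.sum_mul, ← Finset.mul_sum, hp, one_mul, mul_one]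
  have hM : ∑ s, ∑ _b ∈ Finset.univ.erase s, M * N⁻¹ * p s =
      M * N⁻¹ * (Fintype.card S - 1 : ℕ) := by
    simp only [Finset.sum_const, Finset.card_erase_of_mem (Finset.mem_univ _), Finset.card_univ,
      nsmul_eq_mul, ← Finset.mul_sum, hp, mul_one]
    exact mul_comm _ _
  calc samplingLoss p φ = ∑ s, ∑ b ∈ Finset.univ.erase s, p s * p b * φ s b := by
        refine Finset.sum_congr rfl fun s _ => (Finset.sum_erase _ ?_).symm
        rw [hφ0, mul_zero]
    _ ≤ ∑ s, ∑ b ∈ Finset.univ.erase s,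
          (N ^ α * κ * (p s ^ (1 - α) * p b ^ α * (p b * (1 - β b s b))) + p s * p b * ε +
            M * N⁻¹ * p s) := by
        gcongr with s _ b _
        exact mul_mul_le_rpow_mul_add hα0 hα1 hN0 hN (hp1 s) (hφM s b) (hφ s b)
    _ ≤ ∑ s, ∑ b, N ^ α * κ * (p s ^ (1 - α) * p b ^ α * (p b * (1 - β b s b))) +
          ∑ s, ∑ b, p s * p b * ε + ∑ s, ∑ _b ∈ Finset.univ.erase s, M * N⁻¹ * p s := by
        simp only [Finset.sum_add_distrib]
        gcongr <;> exact Finset.subset_univ _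
    _ = _ := by simp only [hε, hM, Finset.mul_sum]

lemma sum_add_nextPotential_le_potential (hp : ∑ s, p s = 1) {β : S → S → S → ℝ≥0∞}
    (hβ : ∀ c s b, β c s b ≤ 1) :
    ∑ s, ∑ b, p s ^ (1 - α) * p b ^ α * (p b * (1 - β b s b)) + nextPotential α p β ≤
      potential α p := by
  simp only [nextPotential, potential, ← Finset.sum_add_distrib, ← mul_add]
  refine Finset.sum_le_sum fun s _ => Finset.sum_le_sum fun b _ => mul_le_of_le_one_right' ?_
  calc p b * (1 - β b s b) + ∑ c, p c * β c s b
      ≤ ∑ c, p c * (1 - β c s b) + ∑ c, p c * β c s b := by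
        gcongr
        exact Finset.single_le_sum_of_canonicallyOrdered
          (f := fun c => p c * (1 - β c s b)) (Finset.mem_univ b)
    _ = 1 := by
        simp only [← Finset.sum_add_distrib, ← mul_add, tsub_add_cancel_of_le (hβ _ s b), mul_one,
          hp]

lemma samplingLoss_add_nextPotential_le (hα0 : 0 ≤ α) (hα1 : α ≤ 1) (hp : ∑ s, p s = 1)
    {φ : S → S → ℝ≥0∞} {β : S → S → S → ℝ≥0∞} {κ ε M N : ℝ≥0∞} (hN0 : N ≠ 0) (hN : N ≠ ∞)
    (hβ : ∀ c s b, β c s b ≤ 1) (hφ0 : ∀ s, φ s s = 0) (hφM : ∀ s b, φ s b ≤ M)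
    (hφ : ∀ s b, φ s b ≤ κ * (1 - β b s b) + ε) :
    samplingLoss p φ + N ^ α * κ * nextPotential α p β ≤
      N ^ α * κ * potential α p + (ε + M * N⁻¹ * (Fintype.card S - 1 : ℕ)) := by
  grw [samplingLoss_le_sum_add hα0 hα1 hp hN0 hN hφ0 hφM hφ,
    ← sum_add_nextPotential_le_potential hp hβ]
  exact le_of_eq (by ring)

end Potential

section PosteriorSampling

lemma ofReal_add_le_min_add_min {u v : ℝ} (h : u + v ≤ 2) :
    ENNReal.ofReal (u + v) ≤ min 2 (ENNReal.ofReal u) + min 2 (ENNReal.ofReal v) := by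
  have h2 : ENNReal.ofReal (u + v) ≤ 2 := ENNReal.ofReal_le_of_le_toReal (by simpa using h)
  rcases le_total 2 (ENNReal.ofReal u) with hu | hu
  · exact le_add_right (by rwa [min_eq_left hu])
  rcases le_total 2 (ENNReal.ofReal v) with hv | hv
  · exact le_add_left (by rwa [min_eq_left hv])
  · rw [min_eq_right hu, min_eq_right hv]
    exact ENNReal.ofReal_add_le

lemma min_two_ofReal_le_of_le_exp {x A B : ℝ} {β : ℝ≥0∞} (hA : 0 < A) (hB : 0 ≤ B) (hβ1 : β ≤ 1)
    (hβ : β ≤ ENNReal.ofReal (Real.exp (-((x - B) / A)))) :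
    min 2 (ENNReal.ofReal x) ≤ ENNReal.ofReal (2 + A) * (1 - β) + ENNReal.ofReal B := by
  lift β to ℝ≥0 using ne_top_of_le_ne_top ENNReal.one_ne_top hβ1
  have hβ1' : (β : ℝ) ≤ 1 := by exact_mod_cast hβ1
  have hβ' : (β : ℝ) ≤ Real.exp (-((x - B) / A)) := by
    simpa [(Real.exp_pos _).le] using ENNReal.toReal_mono ENNReal.ofReal_ne_top hβ
  calc min 2 (ENNReal.ofReal x) = ENNReal.ofReal (min 2 x) := by
        rw [ENNReal.ofReal_min, ENNReal.ofReal_ofNat]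
    _ ≤ ENNReal.ofReal ((2 + A) * (1 - β) + B) :=
        ENNReal.ofReal_le_ofReal (le_mul_one_sub_add_of_le_exp hA hB (min_le_left _ _)
          (min_le_right _ _) β.2 hβ1' hβ')
    _ = ENNReal.ofReal (2 + A) * (1 - β) + ENNReal.ofReal B := by
        rw [ENNReal.ofReal_add (by nlinarith) hB, ENNReal.ofReal_mul (by linarith),
          ENNReal.ofReal_sub _ β.coe_nonneg, ENNReal.ofReal_one, ENNReal.ofReal_coe_nnreal]

/-- By symmetry, the average regret of acting on a sample `b` instead of the true hypothesis `s` is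
that of mistaking the mean of the action of `b` under `b` for its mean under `s`. -/
lemma samplingLoss_regret_le {S ι : Type*} [Fintype S] (p : S → ℝ≥0∞) {m : ι → S → ℝ} {sel : S → ι}
    (hmax : ∀ s i, m i s ≤ m (sel s) s) (hgap : ∀ s i j, m i s - m j s ≤ 1) :
    samplingLoss p (fun s b => ENNReal.ofReal (m (sel s) s - m (sel b) s)) ≤
      samplingLoss p (fun s b => min 2 (ENNReal.ofReal (m (sel b) b - m (sel b) s))) := by
  refine samplingLoss_le_of_add_swap_le fun s b => ?_
  rw [← ENNReal.ofReal_add (sub_nonneg.2 (hmax _ _)) (sub_nonneg.2 (hmax _ _)),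
    show m (sel s) s - m (sel b) s + (m (sel b) b - m (sel s) b) =
      m (sel b) b - m (sel b) s + (m (sel s) s - m (sel s) b) by ring]
  exact ofReal_add_le_min_add_min (by linarith [hgap s (sel s) (sel b), hgap b (sel b) (sel s)])

lemma samplingLoss_regret_add_nextPotential_le {S ι : Type*} [Fintype S] {p : S → ℝ≥0∞}
    (hp : ∑ s, p s = 1) {m : ι → S → ℝ} {sel : S → ι}
    (hmax : ∀ s i, m i s ≤ m (sel s) s) (hgap : ∀ s i j, m i s - m j s ≤ 1)
    {β : ι → S → S → ℝ≥0∞} {α A V : ℝ} (hα0 : 0 ≤ α) (hα1 : α ≤ 1) (hA : 0 < A) (hV : 0 ≤ V)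
    (hβ : ∀ i s b l, β i s b ≤ ENNReal.ofReal (Real.exp (-(l * (m i b - m i s) - V * l ^ 2))))
    {N : ℝ≥0∞} (hN0 : N ≠ 0) (hN : N ≠ ∞) :
    samplingLoss p (fun s b => ENNReal.ofReal (m (sel s) s - m (sel b) s)) +
        N ^ α * ENNReal.ofReal (2 + A) * nextPotential α p (fun c => β (sel c)) ≤
      N ^ α * ENNReal.ofReal (2 + A) * potential α p +
        (ENNReal.ofReal (V / A) + 2 * N⁻¹ * (Fintype.card S - 1 : ℕ)) := by
  have hβ1 (i : ι) (s b : S) : β i s b ≤ 1 := by simpa using hβ i s b 0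
  grw [samplingLoss_regret_le p hmax hgap]
  refine samplingLoss_add_nextPotential_le hα0 hα1 hp hN0 hN (fun c => hβ1 (sel c)) (by simp)
    (fun s b => min_le_left _ _) fun s b => ?_
  refine min_two_ofReal_le_of_le_exp hA (by positivity) (hβ1 _ _ _)
    ((hβ (sel b) s b A⁻¹).trans_eq ?_)
  congr 3
  field_simp

end PosteriorSampling

section Observations

lemma measurable_snoc {E : Type*} [MeasurableSpace E] {t : ℕ} :
    Measurable fun q : (Fin t → E) × E =>
      (Fin.snoc (α := fun _ => E) q.1 q.2 : Fin (t + 1) → E) := by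
  refine measurable_pi_iff.2 fun i => ?_
  refine Fin.lastCases ?_ (fun j => ?_) i
  · simpa only [Fin.snoc_last] using measurable_snd
  · simp only [Fin.snoc_castSucc]
    fun_prop

lemma measurable_snoc_snd {A E : Type*} [MeasurableSpace A] [MeasurableSpace E] {t : ℕ} :
    Measurable fun q : (A × (Fin t → E)) × E =>
      (q.1.1, (Fin.snoc (α := fun _ => E) q.1.2 q.2 : Fin (t + 1) → E)) :=
  measurable_fst.fst.prodMk (measurable_snoc.comp (measurable_fst.snd.prodMk measurable_snd))

lemma obs_snoc {𝒳 𝒮 : Type*} {K t : ℕ} (ω : Fin t → Round 𝒳 𝒮 K) (q : Round 𝒳 𝒮 K) :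
    obs (Fin.snoc (α := fun _ => Round 𝒳 𝒮 K) ω q : Fin (t + 1) → Round 𝒳 𝒮 K) =
      Fin.snoc (α := fun _ => 𝒳 × Fin K × ℝ) (obs ω) (q.1, q.2.2.1, q.2.2.2) := by
  funext i
  refine Fin.lastCases ?_ (fun j => ?_) i <;> simp [obs]

end Observations

section RoundKernel

variable {H 𝒳 𝒮 𝒜 R : Type*} [MeasurableSpace H] [MeasurableSpace 𝒳] [MeasurableSpace 𝒮]
  [MeasurableSpace 𝒜] [MeasurableSpace R]

/-- The law of the observation of one round (context, action, reward) when the context is drawn from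
`κ`, the sampled state from `π` and the reward of the selected action from `η`. -/
noncomputable def roundKernel (κ : Kernel H 𝒳) (π : Kernel H 𝒮) (select : 𝒳 → 𝒮 → 𝒜)
    (hselect : Measurable (Function.uncurry select)) (η : Kernel (𝒜 × 𝒳) R) :
    Kernel H (𝒳 × 𝒜 × R) :=
  ((κ ⊗ₖ π.comap Prod.fst measurable_fst) ⊗ₖ
    η.comap (fun p => (select p.2.1 p.2.2, p.2.1)) (by fun_prop)).map
    (fun q => (q.1.1, select q.1.1 q.1.2, q.2))

variable {κ : Kernel H 𝒳} {π : Kernel H 𝒮} {select : 𝒳 → 𝒮 → 𝒜}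
  {hselect : Measurable (Function.uncurry select)} {η η' : Kernel (𝒜 × 𝒳) R}

instance : IsSFiniteKernel (roundKernel κ π select hselect η) := by
  unfold roundKernel
  infer_instance

variable [IsSFiniteKernel κ] [IsSFiniteKernel π] [IsSFiniteKernel η]

lemma lintegral_roundKernel (h : H) {F : 𝒳 × 𝒜 × R → ℝ≥0∞} (hF : Measurable F) :
    ∫⁻ o, F o ∂roundKernel κ π select hselect η h =
      ∫⁻ x, ∫⁻ b, ∫⁻ r, F (x, select x b, r) ∂η (select x b, x) ∂π h ∂κ h := by
  have hround : Measurable fun q : (𝒳 × 𝒮) × R => (q.1.1, select q.1.1 q.1.2, q.2) := by fun_prop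
  have hFround : Measurable fun q : (𝒳 × 𝒮) × R => F (q.1.1, select q.1.1 q.1.2, q.2) :=
    hF.comp hround
  have hreward : Measurable fun q : 𝒳 × 𝒮 =>
      ∫⁻ r, F (q.1, select q.1 q.2, r) ∂η (select q.1 q.2, q.1) :=
    hFround.lintegral_kernel_prod_right'
      (κ := η.comap (fun q : 𝒳 × 𝒮 => (select q.1 q.2, q.1)) (by fun_prop))
  rw [roundKernel, Kernel.lintegral_map _ hround _ hF, Kernel.lintegral_compProd _ _ _ hFround]
  exact Kernel.lintegral_compProd _ _ _ hreward

lemma lintegral_roundKernel_of_withDensity [IsSFiniteKernel η'] {f : 𝒳 × 𝒜 × R → ℝ≥0∞}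
    (hf : Measurable f)
    (hη : ∀ a x, (η (a, x)).withDensity (fun r => f (x, a, r)) = η' (a, x))
    (h : H) {F : 𝒳 × 𝒜 × R → ℝ≥0∞} (hF : Measurable F) :
    ∫⁻ o, F o ∂roundKernel κ π select hselect η' h =
      ∫⁻ o, f o * F o ∂roundKernel κ π select hselect η h := by
  rw [lintegral_roundKernel h hF, lintegral_roundKernel (F := fun o => f o * F o) h (hf.mul hF)]
  refine lintegral_congr fun x => lintegral_congr fun b => ?_
  rw [← hη, lintegral_withDensity_eq_lintegral_mul _ (by fun_prop) (by fun_prop)]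
  rfl

end RoundKernel

section Likelihood

variable {𝒳 𝒮 Θ : Type*} {K : ℕ} [MeasurableSpace 𝒳] [MeasurableSpace 𝒮]
  {P : Θ → Kernel (Fin K × 𝒳 × 𝒮) ℝ} {θ : Θ}

instance [IsMarkovKernel (P θ)] (s : 𝒮) : IsMarkovKernel (stateKernel P θ s) :=
  Kernel.IsMarkovKernel.comap _ _

variable [Fintype 𝒮]

/-- The measures with respect to which `likelihood` is a density. -/
noncomputable def dominatingKernel (P : Θ → Kernel (Fin K × 𝒳 × 𝒮) ℝ) (θ : Θ) :
    Kernel (Fin K × 𝒳) ℝ :=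
  ∑ s, stateKernel P θ s

instance [IsMarkovKernel (P θ)] : IsFiniteKernel (dominatingKernel P θ) := by
  refine ⟨Fintype.card 𝒮, ENNReal.natCast_lt_top _, fun q => ?_⟩
  simp [dominatingKernel]

lemma measurable_likelihood (s : 𝒮) : Measurable (likelihood (𝒳 := 𝒳) P θ s) :=
  (Kernel.measurable_rnDeriv (stateKernel P θ s) (dominatingKernel P θ)).comp
    (show Measurable fun o : 𝒳 × Fin K × ℝ => ((o.2.1, o.1), o.2.2) by fun_prop)

lemma stateKernel_absolutelyContinuous_dominatingKernel (s : 𝒮) (q : Fin K × 𝒳) :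
    stateKernel P θ s q ≪ dominatingKernel P θ q := by
  refine Measure.absolutelyContinuous_of_le fun A => ?_
  rw [dominatingKernel, Kernel.finsetSum_apply']
  exact Finset.single_le_sum_of_canonicallyOrdered (f := fun i => stateKernel P θ i q A)
    (Finset.mem_univ s)

lemma withDensity_likelihood [IsMarkovKernel (P θ)] (s : 𝒮) (a : Fin K) (x : 𝒳) :
    (dominatingKernel P θ (a, x)).withDensity (fun r => likelihood P θ s (x, a, r)) =
      stateKernel P θ s (a, x) := by
  rw [← Kernel.withDensity_rnDeriv_eq (stateKernel_absolutelyContinuous_dominatingKernel s (a, x)),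
    Kernel.withDensity_apply _ (Kernel.measurable_rnDeriv _ _)]
  rfl

/-- The affinity of the rewards of the action `a` in the latent states `s` and `b`. -/
noncomputable def rewardAffinity (P : Θ → Kernel (Fin K × 𝒳 × 𝒮) ℝ) (θ : Θ) (α : ℝ) (x : 𝒳)
    (a : Fin K) (s b : 𝒮) : ℝ≥0∞ :=
  affinity α (dominatingKernel P θ (a, x)) (fun r => likelihood P θ s (x, a, r))
    (fun r => likelihood P θ b (x, a, r))

lemma rewardAffinity_le [IsMarkovKernel (P θ)] {c : ℝ≥0}
    (hsub : ∀ a x s, HasSubgaussianMGF (fun r => r - meanReward P a x s θ) c (P θ (a, x, s)))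
    {α : ℝ} (hα0 : 0 < α) (hα1 : α < 1) (x : 𝒳) (a : Fin K) (s b : 𝒮) (l : ℝ) :
    rewardAffinity P θ α x a s b ≤ ENNReal.ofReal (Real.exp (-(l * (meanReward P a x b θ -
      meanReward P a x s θ) - c / (2 * α * (1 - α)) * l ^ 2))) := by
  have hmeas (s : 𝒮) : Measurable fun r => likelihood P θ s (x, a, r) :=
    (measurable_likelihood s).comp (by fun_prop)
  refine affinity_le_of_hasSubgaussianMGF measurable_id (hmeas s) (hmeas b) ?_ ?_ hα0 hα1 l
  all_goals
    rw [withDensity_likelihood]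
    exact hsub a x _

variable {P₁ : Measure 𝒮}

lemma weight_snoc {t : ℕ} (h : Hist 𝒳 K t) (o : 𝒳 × Fin K × ℝ) (s : 𝒮) :
    weight P θ P₁ (Fin.snoc (α := fun _ => 𝒳 × Fin K × ℝ) h o : Hist 𝒳 K (t + 1)) s =
      weight P θ P₁ h s * likelihood P θ s o := by
  simp [weight, Fin.prod_univ_castSucc, mul_assoc]

variable [MeasurableSingletonClass 𝒮]

lemma weight_eq_evidence_mul_posteriorMeasure {t : ℕ} {h : Hist 𝒳 K t}
    (hfin : evidence P θ P₁ h ≠ ∞) (s : 𝒮) :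
    weight P θ P₁ h s = evidence P θ P₁ h * posteriorMeasure P θ P₁ h {s} := by
  classical
  by_cases h0 : evidence P θ P₁ h = 0
  · rw [h0, zero_mul]
    exact Finset.sum_eq_zero_iff.1 h0 s (Finset.mem_univ s)
  · simp [posteriorMeasure, h0, hfin, Set.indicator_apply,
      ENNReal.mul_div_cancel h0 hfin]

end Likelihood

section Regret

variable {𝒳 𝒮 Θ : Type*} {K : ℕ} [MeasurableSpace 𝒳] [MeasurableSpace 𝒮]
  {P : Θ → Kernel (Fin K × 𝒳 × 𝒮) ℝ} {θ : Θ}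

/-- The suboptimality `max_{a'} μ(a', x, s, θ) - μ(a, x, s, θ)` of the action `a` in the context `x`
and the latent state `s`. -/
noncomputable def suboptimality (P : Θ → Kernel (Fin K × 𝒳 × 𝒮) ℝ) (θ : Θ) (a : Fin K) (x : 𝒳)
    (s : 𝒮) : ℝ :=
  (⨆ a', meanReward P a' x s θ) - meanReward P a x s θ

lemma suboptimality_nonneg (a : Fin K) (x : 𝒳) (s : 𝒮) : 0 ≤ suboptimality P θ a x s :=
  sub_nonneg.2 (Finite.le_ciSup (fun a' => meanReward P a' x s θ) a)

lemma suboptimality_eq_sub {a₀ : Fin K} {x : 𝒳} {s : 𝒮}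
    (hmax : ∀ a, meanReward P a x s θ ≤ meanReward P a₀ x s θ) (a : Fin K) :
    suboptimality P θ a x s = meanReward P a₀ x s θ - meanReward P a x s θ := by
  have : Nonempty (Fin K) := ⟨a⟩
  rw [suboptimality,
    le_antisymm (ciSup_le hmax) (Finite.le_ciSup (fun a' => meanReward P a' x s θ) a₀)]

lemma suboptimality_le_one
    (hgap : ∀ x s a a', meanReward P a' x s θ - meanReward P a x s θ ≤ 1) (a : Fin K) (x : 𝒳)
    (s : 𝒮) : suboptimality P θ a x s ≤ 1 := by
  have : Nonempty (Fin K) := ⟨a⟩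
  exact sub_le_iff_le_add.2 (ciSup_le fun a' => sub_le_iff_le_add.1 (hgap x s a a'))

lemma measurable_suboptimality :
    Measurable fun q : Fin K × 𝒳 × 𝒮 => suboptimality P θ q.1 q.2.1 q.2.2 := by
  have hmean : Measurable fun q : Fin K × 𝒳 × 𝒮 => meanReward P q.1 q.2.1 q.2.2 θ :=
    (stronglyMeasurable_id.integral_kernel (κ := P θ)).measurable
  refine Measurable.sub (Measurable.iSup fun a => ?_) hmean
  exact hmean.comp (show Measurable fun q : Fin K × 𝒳 × 𝒮 => (a, q.2.1, q.2.2) by fun_prop)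

lemma measurable_ofReal_suboptimality {H : Type*} [MeasurableSpace H] {a : H → Fin K} {x : H → 𝒳}
    {s : H → 𝒮} (ha : Measurable a) (hx : Measurable x) (hs : Measurable s) :
    Measurable fun h => ENNReal.ofReal (suboptimality P θ (a h) (x h) (s h)) :=
  (measurable_suboptimality.comp (ha.prodMk (hx.prodMk hs))).ennreal_ofReal

lemma totalRegret_eq_sum_suboptimality {n : ℕ} (p : 𝒮 × (Fin n → Round 𝒳 𝒮 K)) :
    totalRegret P θ p = ∑ t, suboptimality P θ (p.2 t).2.2.1 (p.2 t).1 p.1 := rfl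

lemma totalRegret_nonneg {n : ℕ} (p : 𝒮 × (Fin n → Round 𝒳 𝒮 K)) : 0 ≤ totalRegret P θ p :=
  Finset.sum_nonneg fun _ _ => suboptimality_nonneg _ _ _

lemma totalRegret_le (hgap : ∀ x s a a', meanReward P a' x s θ - meanReward P a x s θ ≤ 1) {n : ℕ}
    (p : 𝒮 × (Fin n → Round 𝒳 𝒮 K)) : totalRegret P θ p ≤ n := by
  rw [totalRegret_eq_sum_suboptimality]
  refine (Finset.sum_le_sum fun t _ => suboptimality_le_one hgap _ _ _).trans ?_
  simp

lemma totalRegret_snoc {t : ℕ} (s : 𝒮) (ω : Fin t → Round 𝒳 𝒮 K) (q : Round 𝒳 𝒮 K) :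
    totalRegret P θ (s, (Fin.snoc (α := fun _ => Round 𝒳 𝒮 K) ω q : Fin (t + 1) → Round 𝒳 𝒮 K)) =
      totalRegret P θ (s, ω) + suboptimality P θ q.2.2.1 q.1 s := by
  simp [totalRegret_eq_sum_suboptimality, Fin.sum_univ_castSucc]

lemma measurable_totalRegret {n : ℕ} : Measurable (totalRegret (n := n) P θ) :=
  Finset.measurable_sum _ fun t _ => measurable_suboptimality.comp
    (show Measurable fun p : 𝒮 × (Fin n → Round 𝒳 𝒮 K) => ((p.2 t).2.2.1, (p.2 t).1, p.1) by
      fun_prop)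

end Regret

section Law

variable {𝒳 𝒮 Θ : Type*} {K : ℕ} [MeasurableSpace 𝒳] [MeasurableSpace 𝒮] [Fintype 𝒮]

/-- The law of the history if every reward were drawn from the (not normalized) dominating kernel.
Under it `weight` becomes the joint density of the latent state and the history. -/
noncomputable def referenceLaw (P : Θ → Kernel (Fin K × 𝒳 × 𝒮) ℝ) (θstar θhat : Θ)
    (P₁ : Measure 𝒮) (ctx : (t : ℕ) → Kernel (Hist 𝒳 K t) 𝒳)
    (select : 𝒳 → 𝒮 → Fin K) (hselect : Measurable (Function.uncurry select)) :
    (t : ℕ) → Measure (Hist 𝒳 K t)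
  | 0 => Measure.dirac Fin.elim0
  | t + 1 =>
    ((referenceLaw P θstar θhat P₁ ctx select hselect t) ⊗ₘ
      (roundKernel (ctx t) (posteriorKernel P θhat P₁ t) select hselect
        (dominatingKernel P θstar))).map
      (fun q => Fin.snoc (α := fun _ => 𝒳 × Fin K × ℝ) q.1 q.2)

variable {P : Θ → Kernel (Fin K × 𝒳 × 𝒮) ℝ} {θstar θhat : Θ} {P₁ : Measure 𝒮}
  {ctx : (t : ℕ) → Kernel (Hist 𝒳 K t) 𝒳} {select : 𝒳 → 𝒮 → Fin K}
  {hselect : Measurable (Function.uncurry select)}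

instance (t : ℕ) : SFinite (referenceLaw P θstar θhat P₁ ctx select hselect t) := by
  induction t <;> unfold referenceLaw <;> infer_instance

lemma lintegral_referenceLaw_succ (t : ℕ) {F : Hist 𝒳 K (t + 1) → ℝ≥0∞} (hF : Measurable F) :
    ∫⁻ h, F h ∂referenceLaw P θstar θhat P₁ ctx select hselect (t + 1) =
      ∫⁻ h, ∫⁻ o, F (Fin.snoc (α := fun _ => 𝒳 × Fin K × ℝ) h o)
        ∂roundKernel (ctx t) (posteriorKernel P θhat P₁ t) select hselect
          (dominatingKernel P θstar) h
        ∂referenceLaw P θstar θhat P₁ ctx select hselect t := by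
  rw [referenceLaw, lintegral_map hF measurable_snoc]
  exact Measure.lintegral_compProd (hF.comp measurable_snoc)

variable [IsMarkovKernel (P θstar)] [IsProbabilityMeasure P₁] [∀ t, IsMarkovKernel (ctx t)]

instance (t : ℕ) : IsMarkovKernel (contextStep (𝒮 := 𝒮) (ctx t)) :=
  Kernel.IsMarkovKernel.comap _ _

instance (t : ℕ) : IsMarkovKernel (sampleStep P θhat P₁ t) :=
  Kernel.IsMarkovKernel.comap _ _

instance (t : ℕ) : IsMarkovKernel (rewardStep P θstar select hselect t) :=
  Kernel.IsMarkovKernel.comap _ _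

instance (t : ℕ) : IsMarkovKernel (stepKernel P θstar θhat P₁ ctx select hselect t) :=
  Kernel.IsMarkovKernel.map _ (by fun_prop)

instance (t : ℕ) : IsProbabilityMeasure (law P θstar θhat P₁ ctx select hselect t) := by
  induction t with
  | zero => exact Measure.isProbabilityMeasure_map (by fun_prop)
  | succ t ih => exact Measure.isProbabilityMeasure_map measurable_snoc_snd.aemeasurable

lemma lintegral_law_succ (t : ℕ) {F : 𝒮 × (Fin (t + 1) → Round 𝒳 𝒮 K) → ℝ≥0∞}
    (hF : Measurable F) :
    ∫⁻ p, F p ∂law P θstar θhat P₁ ctx select hselect (t + 1) =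
      ∫⁻ p, ∫⁻ q, F (p.1, Fin.snoc (α := fun _ => Round 𝒳 𝒮 K) p.2 q)
        ∂stepKernel P θstar θhat P₁ ctx select hselect t p
        ∂law P θstar θhat P₁ ctx select hselect t := by
  rw [law, lintegral_map hF measurable_snoc_snd]
  exact Measure.lintegral_compProd (hF.comp measurable_snoc_snd)

lemma lintegral_stepKernel (t : ℕ) (s : 𝒮) (ω : Fin t → Round 𝒳 𝒮 K)
    {F : 𝒳 × Fin K × ℝ → ℝ≥0∞} (hF : Measurable F) :
    ∫⁻ q, F (q.1, q.2.2.1, q.2.2.2) ∂stepKernel P θstar θhat P₁ ctx select hselect t (s, ω) =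
      ∫⁻ o, F o ∂roundKernel (ctx t) (posteriorKernel P θhat P₁ t) select hselect
        (stateKernel P θstar s) (obs ω) := by
  have hround : Measurable fun q : (𝒳 × 𝒮) × ℝ => F (q.1.1, select q.1.1 q.1.2, q.2) := by
    fun_prop
  have hreward : Measurable fun q : 𝒳 × 𝒮 =>
      ∫⁻ r, F (q.1, select q.1 q.2, r) ∂rewardStep P θstar select hselect t ((s, ω), q) :=
    hround.lintegral_kernel_prod_right'
      (κ := (rewardStep P θstar select hselect t).comap (fun q => ((s, ω), q)) (by fun_prop))
  rw [stepKernel, Kernel.lintegral_map _ (by fun_prop) _ (by fun_prop),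
    Kernel.lintegral_compProd _ _ _ hround, lintegral_roundKernel _ hF]
  exact Kernel.lintegral_compProd _ _ _ hreward

lemma integrable_totalRegret
    (hgap : ∀ x s a a', meanReward P a' x s θstar - meanReward P a x s θstar ≤ 1) (n : ℕ) :
    Integrable (totalRegret P θstar) (law P θstar θhat P₁ ctx select hselect n) :=
  Integrable.of_bound measurable_totalRegret.aestronglyMeasurable n <|
    Filter.Eventually.of_forall fun p => by
      rw [Real.norm_of_nonneg (totalRegret_nonneg p)]
      exact totalRegret_le hgap p

lemma bayesRegret_le (hgap : ∀ x s a a', meanReward P a' x s θstar - meanReward P a x s θstar ≤ 1)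
    (n : ℕ) : bayesRegret P θstar θhat P₁ ctx select hselect n ≤ n := by
  have hint := integrable_totalRegret (P₁ := P₁) (θhat := θhat) (ctx := ctx) (hselect := hselect)
    hgap n
  simpa [bayesRegret] using integral_mono hint (integrable_const (n : ℝ)) (totalRegret_le hgap)

lemma ofReal_bayesRegret
    (hgap : ∀ x s a a', meanReward P a' x s θstar - meanReward P a x s θstar ≤ 1) (n : ℕ) :
    ENNReal.ofReal (bayesRegret P θstar θhat P₁ ctx select hselect n) =
      ∫⁻ p, ENNReal.ofReal (totalRegret P θstar p) ∂law P θstar θhat P₁ ctx select hselect n :=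
  ofReal_integral_eq_lintegral_ofReal (integrable_totalRegret hgap n)
    (Filter.Eventually.of_forall totalRegret_nonneg)

variable [MeasurableSingletonClass 𝒮]

lemma lintegral_law (t : ℕ) {F : 𝒮 → Hist 𝒳 K t → ℝ≥0∞} (hF : ∀ s, Measurable (F s)) :
    ∫⁻ p, F p.1 (obs p.2) ∂law P θstar θhat P₁ ctx select hselect t =
      ∫⁻ h, ∑ s, weight P θstar P₁ h s * F s h
        ∂referenceLaw P θstar θhat P₁ ctx select hselect t := by
  have hobs {t : ℕ} {F : 𝒮 → Hist 𝒳 K t → ℝ≥0∞} (hF : ∀ s, Measurable (F s)) :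
      Measurable fun p : 𝒮 × (Fin t → Round 𝒳 𝒮 K) => F p.1 (obs p.2) :=
    measurable_from_prod_countable_right fun s => (hF s).comp measurable_obs
  have hweight {t : ℕ} {F : 𝒮 → Hist 𝒳 K t → ℝ≥0∞} (hF : ∀ s, Measurable (F s)) :
      Measurable fun h => ∑ s, weight P θstar P₁ h s * F s h :=
    Finset.measurable_sum _ fun s _ => (measurable_weight P θstar P₁ s).mul (hF s)
  induction t with
  | zero =>
    rw [law, referenceLaw, lintegral_map (hobs hF) (by fun_prop), lintegral_fintype,
      lintegral_dirac' _ (hweight hF)]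
    simp [weight, mul_comm, Subsingleton.elim (obs _) Fin.elim0]
  | succ t ih =>
    have hFsnoc (s : 𝒮) : Measurable fun q : Hist 𝒳 K t × (𝒳 × Fin K × ℝ) =>
        F s (Fin.snoc (α := fun _ => 𝒳 × Fin K × ℝ) q.1 q.2) := (hF s).comp measurable_snoc
    have hround (s : 𝒮) (h : Hist 𝒳 K t) : Measurable fun o : 𝒳 × Fin K × ℝ =>
        F s (Fin.snoc (α := fun _ => 𝒳 × Fin K × ℝ) h o) := (hFsnoc s).comp measurable_prodMk_left
    simp only [lintegral_law_succ t (hobs hF), obs_snoc]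
    simp only [lintegral_stepKernel t _ _ (hround _ _)]
    rw [ih (F := fun s h => ∫⁻ o, F s (Fin.snoc (α := fun _ => 𝒳 × Fin K × ℝ) h o)
        ∂roundKernel (ctx t) (posteriorKernel P θhat P₁ t) select hselect (stateKernel P θstar s) h)
        fun s => (hFsnoc s).lintegral_kernel_prod_right',
      lintegral_referenceLaw_succ t (hweight hF)]
    refine lintegral_congr fun h => ?_
    simp only [weight_snoc, mul_assoc]
    have hlik (s : 𝒮) : Measurable fun o => likelihood P θstar s o *
        F s (Fin.snoc (α := fun _ => 𝒳 × Fin K × ℝ) h o) :=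
      (measurable_likelihood s).mul (hround s h)
    rw [lintegral_finsetSum _ fun s _ => (hlik s).const_mul _]
    refine Finset.sum_congr rfl fun s _ => ?_
    rw [lintegral_const_mul _ (hlik s),
      lintegral_roundKernel_of_withDensity (measurable_likelihood s)
        (fun a x => withDensity_likelihood s a x) h (hround s h)]

lemma lintegral_evidence (t : ℕ) :
    ∫⁻ h, evidence P θstar P₁ h ∂referenceLaw P θstar θhat P₁ ctx select hselect t = 1 := by
  simpa [evidence] using (lintegral_law (P := P) (θstar := θstar) (θhat := θhat) (P₁ := P₁)
    (ctx := ctx) (hselect := hselect) t (F := fun _ _ => 1) fun _ => measurable_const).symm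

lemma ae_evidence_ne_top (t : ℕ) :
    ∀ᵐ h ∂referenceLaw P θstar θhat P₁ ctx select hselect t, evidence P θstar P₁ h ≠ ∞ :=
  (ae_lt_top (measurable_evidence P θstar P₁)
    ((lintegral_evidence t).trans_ne ENNReal.one_ne_top)).mono fun _ => ne_of_lt

end Law

section RegretRecursion

variable {𝒳 𝒮 Θ : Type*} {K : ℕ} [MeasurableSpace 𝒳] [MeasurableSpace 𝒮] [Fintype 𝒮]

/-- The posterior probabilities of the latent states. -/
noncomputable def posteriorMass (P : Θ → Kernel (Fin K × 𝒳 × 𝒮) ℝ) (θ : Θ) (P₁ : Measure 𝒮) {t : ℕ}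
    (h : Hist 𝒳 K t) (s : 𝒮) : ℝ≥0∞ :=
  posteriorMeasure P θ P₁ h {s}

/-- The conditional expectation of the regret of a round given the history and the context, when the
model is known. -/
noncomputable def roundRegret (P : Θ → Kernel (Fin K × 𝒳 × 𝒮) ℝ) (θ : Θ) (P₁ : Measure 𝒮)
    (select : 𝒳 → 𝒮 → Fin K) {t : ℕ} (h : Hist 𝒳 K t) (x : 𝒳) : ℝ≥0∞ :=
  samplingLoss (posteriorMass P θ P₁ h)
    (fun s b => ENNReal.ofReal (suboptimality P θ (select x b) x s))

/-- The conditional expectation of the potential of the posterior at the end of a round given the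
history and the context, when the model is known. -/
noncomputable def roundPotential (P : Θ → Kernel (Fin K × 𝒳 × 𝒮) ℝ) (θ : Θ) (P₁ : Measure 𝒮)
    (select : 𝒳 → 𝒮 → Fin K) (α : ℝ) {t : ℕ} (h : Hist 𝒳 K t) (x : 𝒳) : ℝ≥0∞ :=
  nextPotential α (posteriorMass P θ P₁ h) (fun c => rewardAffinity P θ α x (select x c))

variable {P : Θ → Kernel (Fin K × 𝒳 × 𝒮) ℝ} {θ θhat : Θ} {P₁ : Measure 𝒮}
  {ctx : (t : ℕ) → Kernel (Hist 𝒳 K t) 𝒳} {select : 𝒳 → 𝒮 → Fin K}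
  {hselect : Measurable (Function.uncurry select)} {α : ℝ} {t : ℕ}

lemma measurable_potential_weight :
    Measurable fun h : Hist 𝒳 K t => potential α (weight P θ P₁ h) := by
  have hweight (s : 𝒮) : Measurable fun h : Hist 𝒳 K t => weight P θ P₁ h s :=
    measurable_weight P θ P₁ s
  unfold potential
  fun_prop

variable [MeasurableSingletonClass 𝒮]

lemma measurable_posteriorMass (s : 𝒮) :
    Measurable fun h : Hist 𝒳 K t => posteriorMass P θ P₁ h s :=
  (Measure.measurable_coe (measurableSet_singleton s)).comp (measurable_posteriorMeasure P θ P₁)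

variable [IsProbabilityMeasure P₁]

lemma sum_posteriorMass (h : Hist 𝒳 K t) : ∑ s, posteriorMass P θ P₁ h s = 1 := by
  have : IsProbabilityMeasure (posteriorMeasure P θ P₁ h) :=
    inferInstanceAs (IsProbabilityMeasure (posteriorKernel P θ P₁ t h))
  simp [posteriorMass]

variable [IsMarkovKernel (P θ)]

lemma roundRegret_add_roundPotential_le {c : ℝ≥0}
    (hsub : ∀ a x s, HasSubgaussianMGF (fun r => r - meanReward P a x s θ) c (P θ (a, x, s)))
    (hgap : ∀ x s a a', meanReward P a' x s θ - meanReward P a x s θ ≤ 1)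
    (hmax : ∀ x b a, meanReward P a x b θ ≤ meanReward P (select x b) x b θ)
    (hα0 : 0 < α) (hα1 : α < 1) {A : ℝ} (hA : 0 < A) {N : ℝ≥0∞} (hN0 : N ≠ 0) (hN : N ≠ ∞)
    (h : Hist 𝒳 K t) (x : 𝒳) :
    roundRegret P θ P₁ select h x +
        N ^ α * ENNReal.ofReal (2 + A) * roundPotential P θ P₁ select α h x ≤
      N ^ α * ENNReal.ofReal (2 + A) * potential α (posteriorMass P θ P₁ h) +
        (ENNReal.ofReal (c / (2 * α * (1 - α)) / A) + 2 * N⁻¹ * (Fintype.card 𝒮 - 1 : ℕ)) := by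
  have : 0 < 1 - α := sub_pos.2 hα1
  simp only [roundRegret, suboptimality_eq_sub (hmax x _)]
  exact samplingLoss_regret_add_nextPotential_le (m := fun a s => meanReward P a x s θ)
    (sum_posteriorMass h) (hmax x) (fun s i j => hgap x s j i) hα0.le hα1.le hA (by positivity)
    (fun a s b l => rewardAffinity_le hsub hα0 hα1 x a s b l) hN0 hN

variable [∀ t, IsMarkovKernel (ctx t)]

lemma lintegral_suboptimality_stepKernel (s : 𝒮) (ω : Fin t → Round 𝒳 𝒮 K) :
    ∫⁻ q, ENNReal.ofReal (suboptimality P θ q.2.2.1 q.1 s)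
        ∂stepKernel P θ θhat P₁ ctx select hselect t (s, ω) =
      ∫⁻ x, ∑ b, posteriorMass P θhat P₁ (obs ω) b *
        ENNReal.ofReal (suboptimality P θ (select x b) x s) ∂ctx t (obs ω) := by
  have hsubopt : Measurable fun o : 𝒳 × Fin K × ℝ =>
      ENNReal.ofReal (suboptimality P θ o.2.1 o.1 s) :=
    measurable_ofReal_suboptimality (by fun_prop) (by fun_prop) measurable_const
  rw [lintegral_stepKernel t s ω hsubopt, lintegral_roundKernel _ hsubopt]
  simp only [lintegral_const, measure_univ, mul_one, lintegral_fintype]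
  exact lintegral_congr fun x => Finset.sum_congr rfl fun b _ => mul_comm _ _

lemma lintegral_totalRegret_law_succ (t : ℕ) :
    ∫⁻ p, ENNReal.ofReal (totalRegret P θ p) ∂law P θ θhat P₁ ctx select hselect (t + 1) =
      ∫⁻ p, ENNReal.ofReal (totalRegret P θ p) ∂law P θ θhat P₁ ctx select hselect t +
        ∫⁻ h, ∑ s, weight P θ P₁ h s * ∫⁻ x, ∑ b, posteriorMass P θhat P₁ h b *
          ENNReal.ofReal (suboptimality P θ (select x b) x s) ∂ctx t h
          ∂referenceLaw P θ θhat P₁ ctx select hselect t := by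
  have hregret (t : ℕ) : Measurable fun p : 𝒮 × (Fin t → Round 𝒳 𝒮 K) =>
      ENNReal.ofReal (totalRegret P θ p) := measurable_totalRegret.ennreal_ofReal
  have hround (s : 𝒮) : Measurable fun q : Hist 𝒳 K t × 𝒳 => ∑ b, posteriorMass P θhat P₁ q.1 b *
      ENNReal.ofReal (suboptimality P θ (select q.2 b) q.2 s) :=
    Finset.measurable_sum _ fun b _ => ((measurable_posteriorMass b).comp measurable_fst).mul
      (measurable_ofReal_suboptimality (by fun_prop) (by fun_prop) measurable_const)
  rw [lintegral_law_succ t (hregret (t + 1)),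
    ← lintegral_law (F := fun s h => ∫⁻ x, ∑ b, posteriorMass P θhat P₁ h b *
      ENNReal.ofReal (suboptimality P θ (select x b) x s) ∂ctx t h) t
      fun s => (hround s).lintegral_kernel_prod_right', ← lintegral_add_left (hregret t)]
  refine lintegral_congr fun p => ?_
  simp only [totalRegret_snoc, ENNReal.ofReal_add (totalRegret_nonneg _)
    (suboptimality_nonneg _ _ _), Prod.mk.eta]
  rw [lintegral_add_left measurable_const, lintegral_const, measure_univ, mul_one,
    ← lintegral_suboptimality_stepKernel]

lemma lintegral_totalRegret_law_succ_eq_add_roundRegret (t : ℕ) :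
    ∫⁻ p, ENNReal.ofReal (totalRegret P θ p) ∂law P θ θ P₁ ctx select hselect (t + 1) =
      ∫⁻ p, ENNReal.ofReal (totalRegret P θ p) ∂law P θ θ P₁ ctx select hselect t +
        ∫⁻ h, evidence P θ P₁ h * ∫⁻ x, roundRegret P θ P₁ select h x ∂ctx t h
          ∂referenceLaw P θ θ P₁ ctx select hselect t := by
  rw [lintegral_totalRegret_law_succ]
  congr 1
  refine lintegral_congr_ae ((ae_evidence_ne_top t).mono fun h hfin => ?_)
  have hloss (s : 𝒮) : Measurable fun x : 𝒳 => ∑ b, posteriorMass P θ P₁ h b *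
      ENNReal.ofReal (suboptimality P θ (select x b) x s) :=
    Finset.measurable_sum _ fun b _ =>
      (measurable_ofReal_suboptimality (by fun_prop) measurable_id measurable_const).const_mul _
  simp only [weight_eq_evidence_mul_posteriorMeasure hfin, roundRegret, samplingLoss, mul_assoc,
    ← Finset.mul_sum]
  rw [lintegral_finsetSum _ fun s _ => (hloss s).const_mul _]
  simp only [lintegral_const_mul _ (hloss _)]
  rfl

lemma lintegral_potential_weight_eq (t : ℕ) (hα0 : 0 ≤ α) (hα1 : α ≤ 1) :
    ∫⁻ h, potential α (weight P θ P₁ h) ∂referenceLaw P θ θhat P₁ ctx select hselect t =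
      ∫⁻ h, evidence P θ P₁ h * potential α (posteriorMass P θ P₁ h)
        ∂referenceLaw P θ θhat P₁ ctx select hselect t := by
  refine lintegral_congr_ae ((ae_evidence_ne_top t).mono fun h hfin => ?_)
  simp only [← potential_const_mul hα0 hα1]
  exact congrArg _ (funext (weight_eq_evidence_mul_posteriorMeasure hfin))

lemma lintegral_potential_weight_succ (t : ℕ) (hα0 : 0 ≤ α) (hα1 : α ≤ 1) :
    ∫⁻ h, potential α (weight P θ P₁ h) ∂referenceLaw P θ θ P₁ ctx select hselect (t + 1) =
      ∫⁻ h, evidence P θ P₁ h * ∫⁻ x, roundPotential P θ P₁ select α h x ∂ctx t h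
        ∂referenceLaw P θ θ P₁ ctx select hselect t := by
  rw [lintegral_referenceLaw_succ t measurable_potential_weight]
  refine lintegral_congr_ae ((ae_evidence_ne_top t).mono fun h hfin => ?_)
  have hmass (s : 𝒮) : weight P θ P₁ h s = evidence P θ P₁ h * posteriorMass P θ P₁ h s :=
    weight_eq_evidence_mul_posteriorMeasure hfin s
  have hlik := measurable_likelihood (P := P) (θ := θ)
  have hpotential : Measurable fun o : 𝒳 × Fin K × ℝ =>
      potential α (fun s => posteriorMass P θ P₁ h s * likelihood P θ s o) := by
    unfold potential
    fun_prop
  simp only [funext (weight_snoc h _), hmass, mul_assoc, potential_const_mul hα0 hα1]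
  rw [lintegral_const_mul _ hpotential, lintegral_roundKernel _ hpotential]
  refine congrArg _ (lintegral_congr fun x => ?_)
  rw [lintegral_fintype]
  refine Eq.trans ?_ (sum_mul_lintegral_potential_mul hα0 hα1 _ fun c s =>
    (hlik s).comp (by fun_prop : Measurable fun r : ℝ => (x, select x c, r)))
  exact Finset.sum_congr rfl fun c _ => mul_comm _ _

lemma lintegral_potential_weight_zero_le (hα0 : 0 ≤ α) (hα1 : α ≤ 1) :
    ∫⁻ h, potential α (weight P θ P₁ h) ∂referenceLaw P θ θhat P₁ ctx select hselect 0 ≤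
      Fintype.card 𝒮 :=
  calc _ ≤ ∫⁻ h, Fintype.card 𝒮 * evidence P θ P₁ h
          ∂referenceLaw P θ θhat P₁ ctx select hselect 0 :=
        lintegral_mono fun h => potential_le_card_mul_sum hα0 hα1 _
    _ = Fintype.card 𝒮 := by
        rw [lintegral_const_mul _ (measurable_evidence P θ P₁), lintegral_evidence, mul_one]

lemma lintegral_totalRegret_add_potential_succ_le (hα0 : 0 ≤ α) (hα1 : α ≤ 1) {C D : ℝ≥0∞}
    (hdrift : ∀ (h : Hist 𝒳 K t) x,
      roundRegret P θ P₁ select h x + C * roundPotential P θ P₁ select α h x ≤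
        C * potential α (posteriorMass P θ P₁ h) + D) :
    ∫⁻ p, ENNReal.ofReal (totalRegret P θ p) ∂law P θ θ P₁ ctx select hselect (t + 1) +
        C * ∫⁻ h, potential α (weight P θ P₁ h)
          ∂referenceLaw P θ θ P₁ ctx select hselect (t + 1) ≤
      ∫⁻ p, ENNReal.ofReal (totalRegret P θ p) ∂law P θ θ P₁ ctx select hselect t +
        C * ∫⁻ h, potential α (weight P θ P₁ h) ∂referenceLaw P θ θ P₁ ctx select hselect t +
        D := by
  have hE : Measurable fun h : Hist 𝒳 K t => evidence P θ P₁ h := measurable_evidence P θ P₁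
  have hmass := measurable_posteriorMass (P := P) (θ := θ) (P₁ := P₁) (t := t)
  have hpotential : Measurable fun h : Hist 𝒳 K t =>
      evidence P θ P₁ h * potential α (posteriorMass P θ P₁ h) := by
    unfold potential
    fun_prop
  have hround (h : Hist 𝒳 K t) :
      evidence P θ P₁ h * ∫⁻ x, roundRegret P θ P₁ select h x ∂ctx t h +
          C * (evidence P θ P₁ h * ∫⁻ x, roundPotential P θ P₁ select α h x ∂ctx t h) ≤
        C * (evidence P θ P₁ h * potential α (posteriorMass P θ P₁ h)) +
          D * evidence P θ P₁ h := by
    rw [mul_left_comm C, mul_left_comm C, mul_comm D, ← mul_add, ← mul_add]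
    refine mul_le_mul' le_rfl ?_
    grw [lintegral_const_mul_le, le_lintegral_add, lintegral_mono (hdrift h)]
    simp
  rw [lintegral_totalRegret_law_succ_eq_add_roundRegret, lintegral_potential_weight_succ t hα0 hα1,
    lintegral_potential_weight_eq t hα0 hα1, add_assoc, add_assoc]
  refine add_le_add le_rfl ?_
  grw [lintegral_const_mul_le C, le_lintegral_add, lintegral_mono hround]
  rw [lintegral_add_left (hpotential.const_mul C), lintegral_const_mul C hpotential,
    lintegral_const_mul D hE, lintegral_evidence, mul_one]

lemma lintegral_totalRegret_add_potential_le (hα0 : 0 ≤ α) (hα1 : α ≤ 1) {C D : ℝ≥0∞}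
    (hdrift : ∀ (t : ℕ) (h : Hist 𝒳 K t) x,
      roundRegret P θ P₁ select h x + C * roundPotential P θ P₁ select α h x ≤
        C * potential α (posteriorMass P θ P₁ h) + D) (t : ℕ) :
    ∫⁻ p, ENNReal.ofReal (totalRegret P θ p) ∂law P θ θ P₁ ctx select hselect t +
        C * ∫⁻ h, potential α (weight P θ P₁ h) ∂referenceLaw P θ θ P₁ ctx select hselect t ≤
      C * Fintype.card 𝒮 + t * D := by
  induction t with
  | zero =>
    grw [lintegral_potential_weight_zero_le hα0 hα1]
    simp [totalRegret_eq_sum_suboptimality]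
  | succ t ih =>
    grw [lintegral_totalRegret_add_potential_succ_le hα0 hα1 (hdrift t), ih]
    exact le_of_eq (by push_cast; ring)

lemma bayesRegret_le_of_sampling_parameters {c : ℝ≥0}
    (hsub : ∀ a x s, HasSubgaussianMGF (fun r => r - meanReward P a x s θ) c (P θ (a, x, s)))
    (hgap : ∀ x s a a', meanReward P a' x s θ - meanReward P a x s θ ≤ 1)
    (hmax : ∀ x b a, meanReward P a x b θ ≤ meanReward P (select x b) x b θ)
    (hα0 : 0 < α) (hα1 : α < 1) {A N : ℝ} (hA : 0 < A) (hN : 0 < N) (n : ℕ) :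
    bayesRegret P θ θ P₁ ctx select hselect n ≤
      N ^ α * (2 + A) * Fintype.card 𝒮 +
        n * (c / (2 * α * (1 - α)) / A + 2 * N⁻¹ * (Fintype.card 𝒮 - 1 : ℕ)) := by
  have : 0 < 1 - α := sub_pos.2 hα1
  have hbound := le_self_add.trans <| lintegral_totalRegret_add_potential_le
    (ctx := ctx) (hselect := hselect) hα0.le hα1.le (fun _ => roundRegret_add_roundPotential_le
      (P₁ := P₁) hsub hgap hmax hα0 hα1 hA (ENNReal.ofReal_pos.2 hN).ne' ENNReal.ofReal_ne_top) n
  rw [← ofReal_bayesRegret hgap] at hbound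
  refine (ENNReal.ofReal_le_ofReal_iff (by positivity)).1 (hbound.trans_eq ?_)
  symm
  rw [ENNReal.ofReal_add (by positivity) (by positivity), ENNReal.ofReal_mul (by positivity),
    ENNReal.ofReal_mul (by positivity), ENNReal.ofReal_mul (by positivity),
    ENNReal.ofReal_add (p := c / (2 * α * (1 - α)) / A) (by positivity) (by positivity),
    ENNReal.ofReal_mul (by positivity), ENNReal.ofReal_mul (by positivity),
    ENNReal.ofReal_rpow_of_pos hN, ENNReal.ofReal_inv_of_pos hN]
  simp only [ENNReal.ofReal_natCast, ENNReal.ofReal_ofNat]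

end RegretRecursion

section Tuning

lemma one_le_log {x : ℝ} (hx : 4 ≤ x) : 1 ≤ Real.log x := by
  rw [Real.le_log_iff_exp_le (by linarith)]
  linarith [Real.exp_one_lt_d9]

lemma exp_quarter_le : Real.exp (1 / 4) ≤ 1.285 := by
  refine le_of_pow_le_pow_left₀ four_ne_zero (by norm_num) ?_
  calc Real.exp (1 / 4) ^ 4 = Real.exp 1 := by rw [← Real.exp_nat_mul]; norm_num
    _ ≤ 1.285 ^ 4 := Real.exp_one_lt_d9.le.trans (by norm_num)

lemma sq_rpow_one_div_eight_mul_log {x : ℝ} (hx : 1 < x) :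
    (x ^ 2) ^ (1 / (8 * Real.log x)) = Real.exp (1 / 4) := by
  have hlog := Real.log_pos hx
  rw [Real.rpow_def_of_pos (by positivity), Real.log_pow]
  congr 1
  field_simp
  norm_num

lemma div_two_mul_mul_one_sub_le {c L : ℝ} (hc : 0 ≤ c) (hL : 1 ≤ L) :
    c / (2 * (1 / (8 * L)) * (1 - 1 / (8 * L))) ≤ 32 / 7 * L * c := by
  have hα : 1 / (8 * L) ≤ 1 / 8 := by
    gcongr
    linarith
  calc c / (2 * (1 / (8 * L)) * (1 - 1 / (8 * L))) ≤ c / (2 * (1 / (8 * L)) * (1 - 1 / 8)) := by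
        gcongr
    _ = 32 / 7 * L * c := by field_simp; ring

lemma le_of_forall_pos_le_tuned {r m n σ : ℝ} (hm : 1 ≤ m) (hn : 3 * m < n) (hn4 : 4 ≤ n)
    (hσ : 0 ≤ σ)
    (h : ∀ A > 0, r ≤ Real.exp (1 / 4) * (2 + A) * m +
      n * (σ ^ 2 / (2 * (1 / (8 * Real.log n)) * (1 - 1 / (8 * Real.log n))) / A +
        2 * (n ^ 2)⁻¹ * (m - 1))) :
    r ≤ 3 * m + 2 * σ * √(6 * m * n * Real.log n) := by
  have hlog := one_le_log hn4
  have hV := div_two_mul_mul_one_sub_le (sq_nonneg σ) hlog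
  have hα : 1 / (8 * Real.log n) ≤ 1 := by
    rw [div_le_one (by positivity)]
    linarith
  have hV0 : 0 ≤ σ ^ 2 / (2 * (1 / (8 * Real.log n)) * (1 - 1 / (8 * Real.log n))) := by
    have := sub_nonneg.2 hα
    positivity
  set V := σ ^ 2 / (2 * (1 / (8 * Real.log n)) * (1 - 1 / (8 * Real.log n)))
  have hopt := le_add_two_sqrt_of_forall_pos (r := r)
    (C := 2 * Real.exp (1 / 4) * m + 2 / n * (m - 1)) (a := Real.exp (1 / 4) * m) (b := n * V)
    (by positivity) (by positivity) fun A hA => (h A hA).trans_eq (by field_simp; ring)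
  have hconst : 2 * Real.exp (1 / 4) * m + 2 / n * (m - 1) ≤ 3 * m := by
    have hsmall : 2 / n * (m - 1) ≤ 0.43 * m := by
      rw [div_mul_eq_mul_div, div_le_iff₀ (by linarith)]
      nlinarith
    nlinarith [exp_quarter_le]
  have hsqrt : √(Real.exp (1 / 4) * m * (n * V)) ≤ σ * √(6 * m * n * Real.log n) := by
    rw [← Real.sqrt_sq hσ, ← Real.sqrt_mul (sq_nonneg σ)]
    refine Real.sqrt_le_sqrt ?_
    calc Real.exp (1 / 4) * m * (n * V)
        ≤ 1.285 * m * (n * (32 / 7 * Real.log n * σ ^ 2)) := by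
          gcongr
          exact exp_quarter_le
      _ ≤ σ ^ 2 * (6 * m * n * Real.log n) := by
          have : 0 ≤ σ ^ 2 * (m * n * Real.log n) := by positivity
          linarith
  linarith

end Tuning

end LatentBandit

theorem corollary1 {𝒳 𝒮 Θ : Type*} [MeasurableSpace 𝒳]
    [Fintype 𝒮] [MeasurableSpace 𝒮] [MeasurableSingletonClass 𝒮] {K : ℕ}
    -- the conditional reward distributions `P(· ∣ a, x, s, θ)`
    (P : Θ → Kernel (Fin K × 𝒳 × 𝒮) ℝ) [∀ θ, IsMarkovKernel (P θ)]
    -- the model is known exactly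
    (θstar θhat : Θ) (hθ : θhat = θstar)
    -- rewards are sub-Gaussian with variance proxy `σ ^ 2`
    (σ : ℝ≥0)
    (hσ : ∀ a x s,
      HasSubgaussianMGF (fun r => r - LatentBandit.meanReward P a x s θstar) (σ ^ 2) (P θstar (a, x, s)))
    -- the suboptimality of any action is at most one
    (hgap : ∀ x s a a', LatentBandit.meanReward P a' x s θstar - LatentBandit.meanReward P a x s θstar ≤ 1)
    -- the prior over latent states
    (P₁ : Measure 𝒮) [IsProbabilityMeasure P₁]
    -- the process generating the contexts
    (ctx : (t : ℕ) → Kernel (LatentBandit.Hist 𝒳 K t) 𝒳) [∀ t, IsMarkovKernel (ctx t)]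
    -- the maximizing action chosen by the algorithm for a given context and sampled state
    (select : 𝒳 → 𝒮 → Fin K) (hselect : Measurable (Function.uncurry select))
    (hmax : ∀ x b a, LatentBandit.meanReward P a x b θhat ≤ LatentBandit.meanReward P (select x b) x b θhat)
    (n : ℕ) :
    Integrable (LatentBandit.totalRegret P θstar)
        (LatentBandit.law P θstar θhat P₁ ctx select hselect n) ∧
      LatentBandit.bayesRegret P θstar θhat P₁ ctx select hselect n ≤
        3 * Fintype.card 𝒮 + 2 * σ * √(6 * Fintype.card 𝒮 * n * Real.log n) := by
  subst hθ
  refine ⟨LatentBandit.integrable_totalRegret hgap n, ?_⟩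
  have hcard : 1 ≤ Fintype.card 𝒮 := Fintype.card_pos_iff.2 P₁.nonempty_of_neZero
  rcases le_or_gt n (3 * Fintype.card 𝒮) with hn | hn
  · have hn' : (n : ℝ) ≤ 3 * Fintype.card 𝒮 := by exact_mod_cast hn
    exact (LatentBandit.bayesRegret_le hgap n).trans (hn'.trans (le_add_of_nonneg_right
      (by positivity)))
  · have hn4 : (4 : ℝ) ≤ n := by exact_mod_cast (by omega : 4 ≤ n)
    have hlog := LatentBandit.one_le_log hn4
    refine LatentBandit.le_of_forall_pos_le_tuned (by exact_mod_cast hcard) (by exact_mod_cast hn)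
      hn4 σ.2 fun A hA => ?_
    rw [← LatentBandit.sq_rpow_one_div_eight_mul_log (by linarith : (1 : ℝ) < n),
      ← Nat.cast_pred hcard, ← NNReal.coe_pow]
    exact LatentBandit.bayesRegret_le_of_sampling_parameters hσ hgap hmax (by positivity)
      ((div_lt_one (by positivity)).2 (by linarith)) hA (by positivity) n
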